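/- Let $b>0$ and let $\nu$ be a probability measure on $\mathbb R$ whose support is $[0,b]$ and which has a density that is continuous on $[0,b]$. Let $(X_e)$, $e$ ranging over the nearest-neighbour edges of $\mathbb Z^2$, be i.i.d. with distribution $\nu$. The passage time of a finite nearest-neighbour path is the sum of the weights $X_e$ of its successive edges, and $\mathbf T_n$ is the infimum of the passage times of all paths from $(0,0)$ to $(n,0)$. Let $\mu$ be the time constant, i.e. the deterministic number with $\mathbf T_n/n\to\mu$ almost surely (it is known that it exists and that $0<\mu<b$). For real $\zeta$ and $n\in\mathbb N$ let $\mathcal U_\zeta(n)=\{\mathbf T_n\ge(\mu+\zeta)n\}$. Fix $\zeta\in(0,b-\mu)$. Then for each $\varepsilon>0$ there exists $\varepsilon'>0$ (which may depend on $\nu$, $\zeta$ and $\varepsilon$) such that for all sufficiently large $n$ we have $\mathbb P(\mathcal U_\zeta(n))>0$ and $$\frac{\log\mathbb P(\mathcal U_{\zeta-\varepsilon'}(n))}{n^2}\le\frac{\log\mathbb P(\mathcal U_\zeta(n))}{n^2}+\varepsilon .$$ -/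

import Mathlib

open MeasureTheory Filter Topology

namespace FPP

/-- The nearest-neighbour graph of the square lattice `ℤ²`. -/
def lattice : SimpleGraph (ℤ × ℤ) where
  Adj u v := |u.1 - v.1| + |u.2 - v.2| = 1
  symm := ⟨fun u v h => by rw [abs_sub_comm v.1, abs_sub_comm v.2]; exact h⟩
  loopless := ⟨fun u h => by simp at h⟩

/-- An assignment of a weight to every edge of `ℤ²`. -/
abbrev Env : Type := lattice.edgeSet → ℝ

/-- The passage time of a lattice path: the sum of the weights of its successive edges. -/
def pathTime (X : Env) : {u v : ℤ × ℤ} → lattice.Walk u v → ℝ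
  | _, _, .nil => 0
  | u, _, .cons (v := v) h p => X ⟨s(u, v), h⟩ + pathTime X p

/-- The first passage time between two vertices. -/
noncomputable def passageTime (X : Env) (u v : ℤ × ℤ) : ℝ :=
  ⨅ γ : lattice.Walk u v, pathTime X γ

/-- The passage time between `(0, 0)` and `(n, 0)`. -/
noncomputable def T (X : Env) (n : ℕ) : ℝ := passageTime X (0, 0) ((n : ℤ), 0)

/-- The law of a field of independent edge weights, each with distribution `ν`. -/
noncomputable def law (ν : Measure ℝ) [IsProbabilityMeasure ν] : Measure Env :=
  Measure.infinitePi fun _ : lattice.edgeSet => ν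

instance (ν : Measure ℝ) [IsProbabilityMeasure ν] : IsProbabilityMeasure (law ν) := by
  unfold law; infer_instance

/-- `m` is the almost sure limit of `T n / n`. -/
def IsTimeConstant (ν : Measure ℝ) [IsProbabilityMeasure ν] (m : ℝ) : Prop :=
  ∀ᵐ X ∂(law ν), Tendsto (fun n : ℕ => T X n / n) atTop (𝓝 m)

/-- The time constant: the real number that is the almost sure limit of `T n / n`. -/
noncomputable def timeConstant (ν : Measure ℝ) [IsProbabilityMeasure ν] : ℝ :=
  Classical.epsilon (IsTimeConstant ν)

/-- The almost sure limit is unique, so that the choice above is not one. -/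
theorem IsTimeConstant.eq_timeConstant {ν : Measure ℝ} [IsProbabilityMeasure ν] {m : ℝ}
    (h : IsTimeConstant ν m) : timeConstant ν = m := by
  have h' : IsTimeConstant ν (timeConstant ν) := Classical.epsilon_spec ⟨m, h⟩
  obtain ⟨X, h1, h2⟩ := (h'.and h).exists
  exact tendsto_nhds_unique h1 h2

/-- The class of edge distributions with support `[0, b]` and a density that is continuous
on `[0, b]`. -/
structure IsAdmissible (b : ℝ) (ν : Measure ℝ) : Prop where
  support_eq : ν.support = Set.Icc 0 b
  exists_density : ∃ f : ℝ → ℝ, ContinuousOn f (Set.Icc 0 b) ∧ (∀ x ∈ Set.Icc 0 b, 0 ≤ f x) ∧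
    ν = (volume.restrict (Set.Icc 0 b)).withDensity fun x => ENNReal.ofReal (f x)

/-- The upper tail event `T n ≥ (μ + ζ) n`, where `μ` is the time constant. -/
def upperTail (ν : Measure ℝ) [IsProbabilityMeasure ν] (ζ : ℝ) (n : ℕ) : Set Env :=
  {X | (timeConstant ν + ζ) * n ≤ T X n}

end FPP

/-!
Write `m = μ + ζ`, fix `c` strictly between `max m 0` and `b`, and let `raise c δ` move each weight
below `c` towards `c` by a small fraction `δ` of the distance. Two facts give the theorem.

* *Raising the weights near the box `[-n, n]²` takes* `{T n ≥ (m - ε') n}` *into* `{T n ≥ m n}`, with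
  `ε' = δ (c - m)` (`applyOn_raise_mem_allSlow`). The first `n` edges of any path from `(0, 0)` to
  `(n, 0)` meet the box. Either they take time `m n` already, or raising them gains at least
  `δ (c - m) n`. What the path does far away is irrelevant, so that no control of the location of
  geodesics is needed.

* *Raising a weight inflates the probability of an increasing event by a factor of at most*
  `1 + κ`, with `κ → 0` as `δ → 0` (`IsAdmissible.exists_preimage_raise_le`). The weights above `c`,
  where `ν` may be extremely thin, are not moved, and below `c` boundedness of the density
  suffices. Conditioning on all but one weight, one extends this to the at most `36 n²` edges
  meeting the box, with the factor `(1 + κ) ^ (36 n²)` (`infinitePi_preimage_applyOn_le`).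

Since upper tail events are increasing, `P (T n ≥ (m - ε') n) ≤ (1 + κ) ^ (36 n²) P (T n ≥ m n)`, and
`κ = ε / 36` gives the bound. The events have positive probability because all edges meeting the
box may have weight at least `c` (`law_allSlow_pos`).
-/

namespace FPP

open scoped ENNReal

/-! ### Increasing events of an i.i.d. field -/

section Resampling

variable {ι : Type*} [DecidableEq ι]

theorem isUpperSet_section {A : Set (ι → ℝ)} (hA : IsUpperSet A) (X : ι → ℝ) (e : ι) :
    IsUpperSet {x : ℝ | Function.update X e x ∈ A} := fun _ _ hxy hx =>
  hA (update_le_update_iff.2 ⟨hxy, fun _ _ => le_rfl⟩) hx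

theorem measurable_update_uncurry (e : ι) :
    Measurable fun p : (ι → ℝ) × ℝ => Function.update p.1 e p.2 := by
  refine measurable_pi_lambda _ fun i => ?_
  by_cases h : i = e
  · subst h; simpa using measurable_snd
  · simp only [Function.update_of_ne h]
    exact (measurable_pi_apply i).comp measurable_fst

/-- Resampling one coordinate of an i.i.d. field does not change its law. -/
theorem map_update_infinitePi (ν : Measure ℝ) [IsProbabilityMeasure ν] (e : ι) :
    ((Measure.infinitePi fun _ : ι => ν).prod ν).map
      (fun p : (ι → ℝ) × ℝ => Function.update p.1 e p.2) = Measure.infinitePi fun _ : ι => ν := by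
  refine Measure.eq_infinitePi _ fun s t ht => ?_
  rw [Measure.map_apply (measurable_update_uncurry e)
    (MeasurableSet.pi s.countable_toSet fun i _ => ht i)]
  have hpre : (fun p : (ι → ℝ) × ℝ => Function.update p.1 e p.2) ⁻¹' Set.pi s t =
      (Set.pi (s.erase e : Finset ι) t) ×ˢ (if e ∈ s then t e else Set.univ) := by
    ext ⟨X, x⟩
    simp only [Set.mem_preimage, Set.mem_pi, Set.mem_prod, Finset.mem_coe, Finset.mem_erase]
    constructor
    · intro h
      refine ⟨fun i hi => by simpa [Function.update_of_ne hi.1] using h i hi.2, ?_⟩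
      split_ifs with he
      · simpa using h e he
      · trivial
    · rintro ⟨h1, h2⟩ i hi
      by_cases hie : i = e
      · subst hie; simpa [hi] using h2
      · simpa [Function.update_of_ne hie] using h1 i ⟨hie, hi⟩
  rw [hpre, Measure.prod_prod, Measure.infinitePi_pi _ fun i _ => ht i]
  split_ifs with he
  · exact Finset.prod_erase_mul s (fun i => ν (t i)) he
  · simp [Finset.erase_eq_of_notMem he]

theorem infinitePi_eq_lintegral_section (ν : Measure ℝ) [IsProbabilityMeasure ν] (e : ι)
    {A : Set (ι → ℝ)} (hA : MeasurableSet A) :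
    Measure.infinitePi (fun _ : ι => ν) A =
      ∫⁻ X, ν {x | Function.update X e x ∈ A} ∂Measure.infinitePi fun _ : ι => ν := by
  conv_lhs => rw [← map_update_infinitePi ν e]
  rw [Measure.map_apply (measurable_update_uncurry e) hA,
    Measure.prod_apply (measurable_update_uncurry e hA)]
  rfl

/-- The configuration `X` with `φ` applied to the coordinates in `s`. -/
def applyOn (φ : ℝ → ℝ) (s : Finset ι) (X : ι → ℝ) : ι → ℝ :=
  fun e => if e ∈ s then φ (X e) else X e

theorem applyOn_mono {φ : ℝ → ℝ} (hφ : Monotone φ) (s : Finset ι) :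
    Monotone (applyOn φ s) := fun X Y h e => by
  unfold applyOn
  split_ifs
  exacts [hφ (h e), h e]

theorem measurable_applyOn {φ : ℝ → ℝ} (hφ : Measurable φ) (s : Finset ι) :
    Measurable (applyOn φ s) := by
  refine measurable_pi_lambda _ fun e => ?_
  unfold applyOn
  split_ifs
  exacts [hφ.comp (measurable_pi_apply e), measurable_pi_apply e]

/-- If applying `φ` to one `ν`-distributed variable inflates the probability of every increasing
event by a factor of at most `K`, then applying it to the coordinates in `s` of an i.i.d. field
inflates the probability of every increasing event by a factor of at most `K ^ #s`. The
coordinates are treated one at a time, each by conditioning on all the others. -/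
theorem infinitePi_preimage_applyOn_le {ν : Measure ℝ} [IsProbabilityMeasure ν] {φ : ℝ → ℝ}
    (hφ : Monotone φ) {K : ℝ≥0∞}
    (hK : ∀ S : Set ℝ, IsUpperSet S → MeasurableSet S → ν (φ ⁻¹' S) ≤ K * ν S)
    (s : Finset ι) {A : Set (ι → ℝ)} (hA : IsUpperSet A) (hAm : MeasurableSet A) :
    Measure.infinitePi (fun _ : ι => ν) (applyOn φ s ⁻¹' A) ≤
      K ^ s.card * Measure.infinitePi (fun _ : ι => ν) A := by
  induction s using Finset.induction_on with
  | empty =>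
    have : applyOn φ (∅ : Finset ι) = id := by ext; simp [applyOn]
    simp [this]
  | insert e s he ih =>
    set B := applyOn φ s ⁻¹' A
    have hBu : IsUpperSet B := hA.preimage (applyOn_mono hφ s)
    have hBm : MeasurableSet B := measurable_applyOn hφ.measurable s hAm
    have hstep : Measure.infinitePi (fun _ : ι => ν) (applyOn φ (insert e s) ⁻¹' A) ≤
        K * Measure.infinitePi (fun _ : ι => ν) B := by
      rw [infinitePi_eq_lintegral_section ν e (measurable_applyOn hφ.measurable _ hAm),
        infinitePi_eq_lintegral_section ν e hBm]
      have hmeas : Measurable fun X : ι → ℝ => ν {x | Function.update X e x ∈ B} :=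
        measurable_measure_prodMk_left (measurable_update_uncurry e hBm)
      rw [← lintegral_const_mul K hmeas]
      refine lintegral_mono fun X => ?_
      have hcomm : ∀ x, applyOn φ (insert e s) (Function.update X e x) =
          applyOn φ s (Function.update X e (φ x)) := fun x => by
        ext i
        by_cases hi : i = e
        · subst hi; simp [applyOn, he]
        · simp [applyOn, hi]
      simp only [Set.mem_preimage, hcomm]
      exact hK _ (isUpperSet_section hBu X e)
        ((measurable_update_uncurry e).comp measurable_prodMk_left hBm)
    calc _ ≤ K * (K ^ s.card * Measure.infinitePi (fun _ : ι => ν) A) :=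
          hstep.trans (by gcongr)
      _ = _ := by rw [Finset.card_insert_of_notMem he, pow_succ']; ring

end Resampling

/-! ### Raising a single weight -/

/-- The map that moves each weight below `c` towards `c`, by the fraction `δ` of its distance
to `c`, and fixes the weights above `c`. -/
noncomputable def raise (c δ x : ℝ) : ℝ := x + δ * max (c - x) 0

theorem raise_mono {c δ : ℝ} (h1 : δ ≤ 1) : Monotone (raise c δ) := by
  intro x y hxy
  unfold raise
  rcases le_total (c - x) 0 with hx | hx <;> rcases le_total (c - y) 0 with hy | hy <;>
    simp only [max_eq_left, max_eq_right, hx, hy] <;> nlinarith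

theorem le_raise {c δ : ℝ} (h0 : 0 ≤ δ) (x : ℝ) : x ≤ raise c δ x := by
  unfold raise
  have := mul_nonneg h0 (le_max_right (c - x) 0)
  linarith

theorem add_mul_le_raise {c δ : ℝ} (h0 : 0 ≤ δ) (x : ℝ) : x + δ * (c - x) ≤ raise c δ x := by
  unfold raise
  have := mul_le_mul_of_nonneg_left (le_max_left (c - x) 0) h0
  linarith

theorem IsAdmissible.exists_le_volume {b : ℝ} {ν : Measure ℝ} (hν : IsAdmissible b ν) :
    ∃ M : ℝ, 0 < M ∧ ∀ s : Set ℝ, ν s ≤ ENNReal.ofReal M * volume s := by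
  obtain ⟨f, hf, -, hνf⟩ := hν.exists_density
  obtain ⟨M, hM⟩ := isCompact_Icc.exists_bound_of_continuousOn hf
  refine ⟨max M 1, by positivity, fun s => ?_⟩
  have hle : ν ≤ (volume.restrict (Set.Icc 0 b)).withDensity fun _ => ENNReal.ofReal (max M 1) := by
    rw [hνf]
    refine withDensity_mono ?_
    filter_upwards [ae_restrict_mem measurableSet_Icc] with x hx
    exact ENNReal.ofReal_le_ofReal
      ((le_abs_self _).trans ((hM x hx).trans (le_max_left _ _)))
  refine (hle s).trans ?_
  rw [withDensity_const, Measure.smul_apply, smul_eq_mul]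
  gcongr
  exact Measure.restrict_le_self

theorem IsAdmissible.ae_nonneg {b : ℝ} {ν : Measure ℝ} (hν : IsAdmissible b ν) :
    ∀ᵐ x ∂ν, 0 ≤ x := by
  have h : ∀ᵐ x ∂ν, x ∈ ν.support := Measure.support_mem_ae
  filter_upwards [h] with x hx
  rw [hν.support_eq] at hx
  exact hx.1

theorem IsAdmissible.measure_Ici_pos {b c : ℝ} {ν : Measure ℝ} (hν : IsAdmissible b ν)
    (hb : 0 < b) (hc : c < b) : 0 < ν (Set.Ici c) := by
  have hmem : b ∈ ν.support := by rw [hν.support_eq]; exact ⟨hb.le, le_rfl⟩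
  exact (Measure.mem_support_iff_forall b).1 hmem _ (Ici_mem_nhds hc)

/-- For small `δ`, raising the weight of an edge hardly inflates the probability of an increasing
event. Only the weights in `raise c δ ⁻¹' S \ S` matter: if there are any, then `[c, ∞) ⊆ S`, so
that `S` is not unlikely, while these weights fill an interval of length at most `δ * c`. -/
theorem IsAdmissible.exists_preimage_raise_le {b c κ : ℝ} {ν : Measure ℝ} [IsProbabilityMeasure ν]
    (hν : IsAdmissible b ν) (hc0 : 0 < c) (hcb : c < b) (hκ : 0 < κ) :
    ∃ δ : ℝ, 0 < δ ∧ δ ≤ 1 ∧ ∀ S : Set ℝ, IsUpperSet S → MeasurableSet S →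
      ν (raise c δ ⁻¹' S) ≤ ENNReal.ofReal (1 + κ) * ν S := by
  obtain ⟨M, hM0, hM⟩ := hν.exists_le_volume
  have hp : 0 < ν.real (Set.Ici c) :=
    ENNReal.toReal_pos (hν.measure_Ici_pos (hc0.trans hcb) hcb).ne' (measure_ne_top _ _)
  set p := ν.real (Set.Ici c) with hpdef
  have hδ0 : 0 < min 1 (κ * p / (M * c)) := lt_min one_pos (by positivity)
  refine ⟨min 1 (κ * p / (M * c)), hδ0, min_le_left _ _, fun S hS hSm => ?_⟩
  set δ := min 1 (κ * p / (M * c)) with hδ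
  have hδM : M * (δ * c) ≤ κ * p := by
    have h := min_le_right 1 (κ * p / (M * c))
    rw [← hδ, le_div_iff₀ (by positivity)] at h
    linarith
  have hlt : ∀ x, x ∈ raise c δ ⁻¹' S \ S → x < c := by
    rintro x ⟨hx, hxS⟩
    by_contra hcx
    apply hxS
    simpa [raise, max_eq_right (sub_nonpos.2 (not_lt.1 hcx))] using hx
  -- The weights that `raise` brings into `S` lie below `c`, and differ by at most `δ * c`.
  by_cases hne : (raise c δ ⁻¹' S \ S).Nonempty
  · obtain ⟨z, hz⟩ := hne
    have hcS : c ∈ S := by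
      refine hS ?_ hz.1
      have := raise_mono (c := c) (min_le_left 1 (κ * p / (M * c))) (hlt z hz).le
      rw [← hδ] at this
      simpa [raise] using this
    have hpS : ENNReal.ofReal p ≤ ν S := by
      rw [hpdef, ofReal_measureReal]
      exact measure_mono fun x hx => hS hx hcS
    have hdiam : ν (raise c δ ⁻¹' S \ S) ≤ ENNReal.ofReal (κ * p) := by
      have hae : ν (raise c δ ⁻¹' S \ S) ≤ ν ((raise c δ ⁻¹' S \ S) ∩ Set.Ici 0) := by
        refine measure_mono_ae ?_
        filter_upwards [hν.ae_nonneg] with x hx hxS using ⟨hxS, hx⟩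
      refine hae.trans ((hM _).trans ?_)
      have hvol : volume ((raise c δ ⁻¹' S \ S) ∩ Set.Ici 0) ≤ ENNReal.ofReal (δ * c) := by
        refine (Real.volume_le_diam _).trans (Metric.ediam_le fun x hx y hy => ?_)
        rw [edist_dist, Real.dist_eq]
        have key : ∀ x y : ℝ, x ∈ (raise c δ ⁻¹' S \ S) ∩ Set.Ici 0 →
            y ∈ (raise c δ ⁻¹' S \ S) ∩ Set.Ici 0 → y - x ≤ δ * c := by
          intro x y hx hy
          have h1 : y < raise c δ x := by
            by_contra h
            exact hy.1.2 (hS (not_lt.1 h) hx.1.1)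
          rw [raise, max_eq_left (sub_nonneg.2 (hlt x hx.1).le)] at h1
          have := mul_nonneg hδ0.le hx.2
          nlinarith
        exact ENNReal.ofReal_le_ofReal (abs_le.2
          ⟨by linarith [key x y hx hy], by linarith [key y x hy hx]⟩)
      calc _ ≤ ENNReal.ofReal M * ENNReal.ofReal (δ * c) := by gcongr
        _ = ENNReal.ofReal (M * (δ * c)) := (ENNReal.ofReal_mul hM0.le).symm
        _ ≤ _ := ENNReal.ofReal_le_ofReal hδM
    calc ν (raise c δ ⁻¹' S) ≤ ν S + ν (raise c δ ⁻¹' S \ S) := by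
          refine (measure_mono ?_).trans (measure_union_le _ _)
          rw [Set.union_sdiff_self]
          exact Set.subset_union_right
      _ ≤ ν S + ENNReal.ofReal κ * ν S := by
          gcongr
          rw [ENNReal.ofReal_mul hκ.le] at hdiam
          exact hdiam.trans (by gcongr)
      _ = _ := by rw [ENNReal.ofReal_add zero_le_one hκ.le, ENNReal.ofReal_one]; ring
  · have hsub : raise c δ ⁻¹' S ⊆ S := fun x hx => by
      by_contra hxS
      exact hne ⟨x, hx, hxS⟩
    calc _ ≤ 1 * ν S := by rw [one_mul]; exact measure_mono hsub
      _ ≤ _ := by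
        gcongr
        rw [← ENNReal.ofReal_one]
        exact ENNReal.ofReal_le_ofReal (by linarith)

/-! ### Passage times of paths -/

theorem pathTime_mono {X Y : Env} (h : X ≤ Y) {u v : ℤ × ℤ} (γ : lattice.Walk u v) :
    pathTime X γ ≤ pathTime Y γ := by
  induction γ with
  | nil => exact le_rfl
  | cons h' p ih => exact add_le_add (h _) ih

theorem pathTime_nonneg {X : Env} (h : ∀ e, 0 ≤ X e) {u v : ℤ × ℤ} (γ : lattice.Walk u v) :
    0 ≤ pathTime X γ := by
  induction γ with
  | nil => exact le_rfl
  | cons h' p ih => exact add_nonneg (h _) ih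

theorem measurable_pathTime {u v : ℤ × ℤ} (γ : lattice.Walk u v) :
    Measurable fun X : Env => pathTime X γ := by
  induction γ with
  | nil => exact measurable_const
  | cons h' p ih => exact (measurable_pi_apply _).add ih

instance countable_walk (u v : ℤ × ℤ) : Countable (lattice.Walk u v) :=
  Function.Injective.countable (f := fun p : lattice.Walk u v => p.support)
    fun _ _ h => SimpleGraph.Walk.ext_support h

theorem abs_sub_le_length {u v : ℤ × ℤ} (γ : lattice.Walk u v) :
    |u.1 - v.1| ≤ γ.length := by
  induction γ with
  | nil => simp
  | @cons u w v h p ih =>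
    have h1 : |u.1 - w.1| + |u.2 - w.2| = 1 := h
    have := abs_sub_le u.1 w.1 v.1
    have := abs_nonneg (u.2 - w.2)
    simp only [SimpleGraph.Walk.length_cons, Nat.cast_add, Nat.cast_one]
    linarith

/-- The vertices of the box `[-n, n]²`. -/
noncomputable def box (n : ℕ) : Finset (ℤ × ℤ) := Finset.Icc (-n : ℤ) n ×ˢ Finset.Icc (-n : ℤ) n

open Classical in
/-- The edges with an endpoint in the box `[-n, n]²`. -/
noncomputable def boxEdges (n : ℕ) : Finset lattice.edgeSet :=
  ((box n ×ˢ ({(1, 0), (-1, 0), (0, 1), (0, -1)} : Finset (ℤ × ℤ))).image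
    fun q => s(q.1, q.1 + q.2)).subtype (· ∈ lattice.edgeSet)

theorem mem_boxEdges {n : ℕ} {u w : ℤ × ℤ} (hu : u ∈ box n) (h : lattice.Adj u w) :
    (⟨s(u, w), h⟩ : lattice.edgeSet) ∈ boxEdges n := by
  classical
  simp only [boxEdges, Finset.mem_subtype, Finset.mem_image, Finset.mem_product]
  refine ⟨(u, w - u), ⟨hu, ?_⟩, by simp⟩
  have h1 : |u.1 - w.1| + |u.2 - w.2| = 1 := h
  obtain ⟨u1, u2⟩ := u
  obtain ⟨w1, w2⟩ := w
  simp only [Prod.mk_sub_mk, Finset.mem_insert, Finset.mem_singleton, Prod.mk.injEq]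
  simp only at h1
  rcases abs_cases (u1 - w1) with ⟨h2, h3⟩ | ⟨h2, h3⟩ <;>
    rcases abs_cases (u2 - w2) with ⟨h4, h5⟩ | ⟨h4, h5⟩ <;> omega

theorem card_boxEdges_le {n : ℕ} (hn : 1 ≤ n) : (boxEdges n).card ≤ 36 * n ^ 2 := by
  classical
  have h1 : (boxEdges n).card ≤ (2 * n + 1) * (2 * n + 1) * 4 := by
    unfold boxEdges
    rw [Finset.card_subtype]
    refine (Finset.card_filter_le _ _).trans (Finset.card_image_le.trans ?_)
    rw [Finset.card_product, box, Finset.card_product, Int.card_Icc]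
    have : ((n : ℤ) + 1 - -n).toNat = 2 * n + 1 := by omega
    rw [this]
    gcongr
    exact Finset.card_le_four
  nlinarith

/-- Suppose that `Y` exceeds the nonnegative weights `X`, by at least the fraction `δ` of the
distance to `c` on the edges meeting the box `[-n, n]²`. The first `k` edges of a path of length
at least `k` that starts at `ℓ¹`-distance at most `n - k` from the origin meet the box; if `S` is
their `X`-time, then the `Y`-time of the path exceeds its `X`-time by at least `δ (c k - S)`. -/
theorem exists_pathTime_gain {n : ℕ} {c δ : ℝ} {X Y : Env} (hX : ∀ e, 0 ≤ X e) (hXY : X ≤ Y)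
    (hY : ∀ e ∈ boxEdges n, X e + δ * (c - X e) ≤ Y e) {u v : ℤ × ℤ} (γ : lattice.Walk u v)
    (k : ℕ) (hk : k ≤ γ.length) (hu : |u.1| + |u.2| + k ≤ n) :
    ∃ S ≤ pathTime X γ, pathTime X γ + δ * (c * k - S) ≤ pathTime Y γ := by
  induction γ generalizing k with
  | nil => exact ⟨0, le_rfl, by simp_all [pathTime]⟩
  | @cons u w v h p ih =>
    rcases k with _ | k
    · exact ⟨0, pathTime_nonneg hX _, by simpa using pathTime_mono hXY _⟩
    · have h1 : |u.1 - w.1| + |u.2 - w.2| = 1 := h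
      have h2 := abs_sub_abs_le_abs_sub w.1 u.1
      have h3 := abs_sub_abs_le_abs_sub w.2 u.2
      rw [abs_sub_comm] at h2 h3
      push_cast at hu
      obtain ⟨S, hS, hS'⟩ := ih k (by simpa using hk) (by linarith)
      refine ⟨X ⟨s(u, w), h⟩ + S, by simpa [pathTime] using hS, ?_⟩
      have hub : u ∈ box n := by
        simp only [box, Finset.mem_product, Finset.mem_Icc, ← abs_le]
        have := abs_nonneg u.1
        have := abs_nonneg u.2
        constructor <;> linarith
      have := hY _ (mem_boxEdges hub h)
      simp only [pathTime]
      push_cast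
      linarith

/-! ### Upper tail events -/

/-- The event that every path from `(0, 0)` to `(n, 0)` has passage time at least `a n`. -/
def allSlow (a : ℝ) (n : ℕ) : Set Env :=
  {X | ∀ γ : lattice.Walk (0, 0) ((n : ℤ), 0), a * n ≤ pathTime X γ}

theorem isUpperSet_allSlow (a : ℝ) (n : ℕ) : IsUpperSet (allSlow a n) :=
  fun _ _ hXY hX γ => (hX γ).trans (pathTime_mono hXY γ)

theorem measurableSet_allSlow (a : ℝ) (n : ℕ) : MeasurableSet (allSlow a n) := by
  rw [allSlow, Set.ofPred_forall]
  exact MeasurableSet.iInter fun γ => measurableSet_le measurable_const (measurable_pathTime γ)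

theorem nonempty_walk (n : ℕ) : Nonempty (lattice.Walk (0, 0) ((n : ℤ), 0)) := by
  induction n with
  | zero => exact ⟨.nil⟩
  | succ n ih =>
    obtain ⟨p⟩ := ih
    exact ⟨p.concat (by simp [lattice])⟩

theorem ae_law_nonneg {b : ℝ} {ν : Measure ℝ} [IsProbabilityMeasure ν] (hν : IsAdmissible b ν) :
    ∀ᵐ X ∂law ν, ∀ e, 0 ≤ X e := by
  rw [ae_all_iff]
  intro e
  have h := (measurePreserving_eval_infinitePi (fun _ : lattice.edgeSet => ν) e)
  exact h.quasiMeasurePreserving.ae hν.ae_nonneg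

/-- The two events differ only where `T` is a junk value, the infimum of a set that is not bounded
below; that needs negative weights. -/
theorem law_upperTail {b : ℝ} {ν : Measure ℝ} [IsProbabilityMeasure ν] (hν : IsAdmissible b ν)
    (ζ : ℝ) (n : ℕ) :
    law ν (upperTail ν ζ n) = law ν (allSlow (timeConstant ν + ζ) n) := by
  refine measure_congr ?_
  filter_upwards [ae_law_nonneg hν] with X hX
  have := nonempty_walk n
  have hbdd : BddBelow (Set.range fun γ : lattice.Walk (0, 0) ((n : ℤ), 0) => pathTime X γ) :=
    ⟨0, by rintro _ ⟨γ, rfl⟩; exact pathTime_nonneg hX γ⟩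
  exact propext (le_ciInf_iff hbdd)

theorem le_length_of_walk {n : ℕ} (γ : lattice.Walk (0, 0) ((n : ℤ), 0)) : n ≤ γ.length := by
  simpa using abs_sub_le_length γ

open Classical in
/-- Raising the weights near the box slows every path. If the first `n` edges of a path already
take time `m n`, there is nothing to gain; otherwise raising them gains at least `δ (c - m) n`. -/
theorem applyOn_raise_mem_allSlow {c δ m : ℝ} (h0 : 0 ≤ δ) {n : ℕ} {X : Env}
    (hX0 : ∀ e, 0 ≤ X e) (hX : X ∈ allSlow (m - δ * (c - m)) n) :
    applyOn (raise c δ) (boxEdges n) X ∈ allSlow m n := by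
  intro γ
  have hXY : X ≤ applyOn (raise c δ) (boxEdges n) X := fun e => by
    unfold applyOn
    split_ifs
    exacts [le_raise h0 _, le_rfl]
  obtain ⟨S, hS, hS'⟩ := exists_pathTime_gain (n := n) (c := c) (δ := δ) hX0 hXY
    (fun e he => by simpa [applyOn, he] using add_mul_le_raise h0 (X e)) γ n (le_length_of_walk γ) (by simp)
  rcases le_total (m * n) S with h | h
  · exact h.trans (hS.trans (pathTime_mono hXY γ))
  · have := hX γ
    have := mul_le_mul_of_nonneg_left h h0
    nlinarith

/-- All paths are slow when all edges meeting the box have weight at least `c`. -/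
theorem law_allSlow_pos {b c m : ℝ} {ν : Measure ℝ} [IsProbabilityMeasure ν]
    (hν : IsAdmissible b ν) (hb : 0 < b) (hcb : c < b) (hmc : m ≤ c) (n : ℕ) :
    0 < law ν (allSlow m n) := by
  have hpos : 0 < law ν (Set.pi (boxEdges n) fun _ => Set.Ici c) := by
    rw [law, Measure.infinitePi_pi _ fun _ _ => measurableSet_Ici]
    exact pos_iff_ne_zero.2 (Finset.prod_ne_zero_iff.2
      fun _ _ => (hν.measure_Ici_pos hb hcb).ne')
  refine hpos.trans_le (measure_mono_ae ?_)
  filter_upwards [ae_law_nonneg hν] with X hX0 hX γ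
  -- With `δ = 1` and zero weights as the lower field, the gain is the whole passage time.
  obtain ⟨S, hS, hS'⟩ := exists_pathTime_gain (n := n) (c := c) (δ := 1) (X := 0) (fun _ => le_rfl) hX0
    (fun e he => by simpa using hX e he) γ n (le_length_of_walk γ) (by simp)
  have h0 := pathTime_nonneg (X := 0) (fun _ => le_rfl) γ
  have := mul_le_mul_of_nonneg_right hmc (n.cast_nonneg (α := ℝ))
  linarith

end FPP

open FPP in
theorem propositionp (b : ℝ) (hb : 0 < b) (ν : Measure ℝ) [IsProbabilityMeasure ν]
    (hν : FPP.IsAdmissible b ν) (ζ : ℝ) (hζ : ζ ∈ Set.Ioo 0 (b - FPP.timeConstant ν))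
    (ε : ℝ) (hε : 0 < ε) :
    ∃ ε' : ℝ, 0 < ε' ∧ ∀ᶠ n : ℕ in atTop,
      0 < (FPP.law ν).real (FPP.upperTail ν ζ n) ∧
      Real.log ((FPP.law ν).real (FPP.upperTail ν (ζ - ε') n)) / (n : ℝ) ^ 2 ≤
        Real.log ((FPP.law ν).real (FPP.upperTail ν ζ n)) / (n : ℝ) ^ 2 + ε := by
  classical
  set m := timeConstant ν + ζ with hm
  have hmb : m < b := by linarith [hζ.2]
  obtain ⟨c, hc, hcb⟩ := exists_between (max_lt hmb hb)
  have hmc : m < c := (le_max_left _ _).trans_lt hc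
  have hc0 : 0 < c := (le_max_right _ _).trans_lt hc
  obtain ⟨δ, hδ0, hδ1, hδ⟩ := hν.exists_preimage_raise_le hc0 hcb (κ := ε / 36) (by positivity)
  have hε' : 0 < δ * (c - m) := mul_pos hδ0 (sub_pos.2 hmc)
  refine ⟨δ * (c - m), hε', ?_⟩
  filter_upwards [eventually_ge_atTop 1] with n hn
  have hn2 : (0 : ℝ) < (n : ℝ) ^ 2 := by positivity
  have hshift : timeConstant ν + (ζ - δ * (c - m)) = m - δ * (c - m) := by rw [hm]; ring
  simp only [Measure.real, law_upperTail hν, hshift, ← hm]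
  have hpos : 0 < (law ν (allSlow m n)).toReal :=
    ENNReal.toReal_pos (law_allSlow_pos hν hb hcb hmc.le n).ne' (measure_ne_top _ _)
  have hpos' : 0 < (law ν (allSlow (m - δ * (c - m)) n)).toReal :=
    ENNReal.toReal_pos (law_allSlow_pos hν hb hcb (by linarith) n).ne' (measure_ne_top _ _)
  refine ⟨hpos, ?_⟩
  have hle : law ν (allSlow (m - δ * (c - m)) n) ≤
      ENNReal.ofReal (1 + ε / 36) ^ (boxEdges n).card * law ν (allSlow m n) := by
    refine (measure_mono_ae ?_).trans (infinitePi_preimage_applyOn_le (raise_mono hδ1) hδ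
      (boxEdges n) (isUpperSet_allSlow m n) (measurableSet_allSlow m n))
    filter_upwards [ae_law_nonneg hν] with X hX0 hX
      using applyOn_raise_mem_allSlow hδ0.le hX0 hX
  have hle' : (law ν (allSlow (m - δ * (c - m)) n)).toReal ≤
      (1 + ε / 36) ^ (boxEdges n).card * (law ν (allSlow m n)).toReal := by
    have := ENNReal.toReal_mono (ENNReal.mul_ne_top (by simp) (measure_ne_top _ _)) hle
    rwa [ENNReal.toReal_mul, ENNReal.toReal_pow, ENNReal.toReal_ofReal (by positivity)] at this
  have hlog := Real.log_le_log hpos' hle'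
  rw [Real.log_mul (by positivity) hpos.ne', Real.log_pow] at hlog
  have hlog1 : Real.log (1 + ε / 36) ≤ ε / 36 := by
    have := Real.log_le_sub_one_of_pos (show 0 < 1 + ε / 36 by positivity)
    linarith
  have hlog0 : 0 ≤ Real.log (1 + ε / 36) := Real.log_nonneg (by linarith)
  have hcard : ((boxEdges n).card : ℝ) ≤ 36 * (n : ℝ) ^ 2 := by
    exact_mod_cast card_boxEdges_le hn
  have hprod : (boxEdges n).card * Real.log (1 + ε / 36) ≤ ε * (n : ℝ) ^ 2 :=
    calc _ ≤ 36 * (n : ℝ) ^ 2 * (ε / 36) := by gcongr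
      _ = _ := by ring
  rw [div_add' _ _ _ hn2.ne', div_le_div_iff_of_pos_right hn2]
  linarith
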